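/- Let $p$ be a prime, $\omega=\exp(2\pi i/p)$, and $\mathrm{Tr}$ the trace of $\mathbb{Q}(\omega)/\mathbb{Q}$. For an integer $N\ge 1$ let $$\mathcal{B}(p,N)=\{a_1\omega+\cdots+a_{p-1}\omega^{p-1} : a_1,\dots,a_{p-1}\in[-N,N]\cap\mathbb{Z}\},$$ and call $(a_1,\dots,a_{p-1})$ the vector associated with $a_1\omega+\cdots+a_{p-1}\omega^{p-1}$. For $\gamma\in\mathbb{Q}(\omega)$ put $\psi(\gamma)=(\mathrm{Tr}(\gamma\omega),\dots,\mathrm{Tr}(\gamma\omega^{p-1}))$, let $d(\alpha,\beta)=\|\psi(\beta)-\psi(\alpha)\|$ with the Euclidean norm, and let $$\mathfrak{d}_{p,N}(\alpha,\beta)=\frac{d(\alpha,\beta)}{\operatorname{diam}\mathcal{B}(p,N)},\qquad \operatorname{diam}\mathcal{B}(p,N)=\max_{\alpha,\beta\in\mathcal{B}(p,N)}d(\alpha,\beta).$$ Points $\alpha,\beta\in\mathcal{B}(p,N)$ are visible from each other if the straight segment between their associated vectors contains no vector associated with a point of $\mathcal{B}(p,N)$ other than its end points. For $K\ge 2$ let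 $\Omega_K(p,N)$ be the set of self-visible $K$-polytopes with vertices in $\mathcal{B}(p,N)$, that is, of all $K$-tuples $(\alpha_1,\dots,\alpha_K)\in\mathcal{B}(p,N)^K$ such that $\alpha_j$ and $\alpha_k$ are visible from each other for all $j\ne k$. **Theorem.** For every real $\varepsilon>0$ and every integer $K\ge 2$ there is a constant $C_{\varepsilon,K}$, effectively computable in the sense that it is a natural number given by a computable function of the pair of natural numbers $(\lceil 1/\varepsilon\rceil,K)$, such that for every prime $p>C_{\varepsilon,K}$ and every positive integer $N$ with $N/p\ge C_{\varepsilon,K}$, $$\frac{1}{\#\Omega_K(p,N)}\,\#\Big\{(\alpha_1,\dots,\alpha_K)\in\Omega_K(p,N) : \max_{1\le j<k\le K}\Big|\mathfrak{d}_{p,N}(\alpha_j,\alpha_k)-\frac{1}{\sqrt6}\Big|\le\varepsilon\Big\}\ge 1-\varepsilon .$$ -/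

import Mathlib

noncomputable section

/-- The root of unity `ω = exp (2πi / p)`. -/
def zetaRoot (p : ℕ) : ℂ := Complex.exp (2 * Real.pi * Complex.I / p)

/-- The cyclotomic field `ℚ(ω)`, as a subfield of `ℂ`. -/
abbrev CycField (p : ℕ) : Type := IntermediateField.adjoin ℚ {zetaRoot p}

/-- `ω` as an element of `ℚ(ω)`. -/
def cycOmega (p : ℕ) : CycField p := IntermediateField.AdjoinSimple.gen ℚ (zetaRoot p)

/-- The element `a₁ ω + ⋯ + a_{p-1} ω^(p-1)` whose associated vector is `a = (a₁, …, a_{p-1})`;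
the coordinate `a_j` is `a i` with `i = j - 1`. -/
def cycPoint (p : ℕ) (a : Fin (p - 1) → ℤ) : CycField p :=
  ∑ i : Fin (p - 1), (a i : CycField p) * cycOmega p ^ ((i : ℕ) + 1)

/-- The box `B(p, N)` of cyclotomic lattice points. -/
def cycBox (p N : ℕ) : Set (CycField p) :=
  {α | ∃ a : Fin (p - 1) → ℤ, (∀ i, a i ∈ Set.Icc (-(N : ℤ)) N) ∧ cycPoint p a = α}

/-- The trace-map image `ψ(γ) = (Tr (γ ω), …, Tr (γ ω^(p-1)))`. -/
def cycPsi (p : ℕ) (γ : CycField p) : EuclideanSpace ℝ (Fin (p - 1)) :=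
  WithLp.toLp 2 fun j : Fin (p - 1) =>
    ((Algebra.trace ℚ (CycField p) (γ * cycOmega p ^ ((j : ℕ) + 1)) : ℚ) : ℝ)

/-- The cyclotomic distance. -/
def cycDist (p : ℕ) (α β : CycField p) : ℝ := ‖cycPsi p β - cycPsi p α‖

/-- The diameter of `B(p, N)` in the cyclotomic distance (a maximum, since the box is finite). -/
def cycDiam (p N : ℕ) : ℝ := sSup (Set.image2 (cycDist p) (cycBox p N) (cycBox p N))

/-- The normalized distance. -/
def normDist (p N : ℕ) (α β : CycField p) : ℝ := cycDist p α β / cycDiam p N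

/-- For points `α`, `β` of the box: on the straight segment joining their associated vectors there
is no associated vector of a point of the box other than the two end points. -/
def CycVisible (p N : ℕ) (α β : CycField p) : Prop :=
  ∀ a b c : Fin (p - 1) → ℤ, cycPoint p a = α → cycPoint p b = β → cycPoint p c ∈ cycBox p N →
    (fun i => (c i : ℝ)) ∈ segment ℝ (fun i => (a i : ℝ)) (fun i => (b i : ℝ)) → c = a ∨ c = b

/-- `Ω_K(p, N)`: the self-visible `K`-polytopes with vertices in `B(p, N)`, as `K`-tuples. -/
def selfVisible (K p N : ℕ) : Set (Fin K → CycField p) :=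
  {α | (∀ j, α j ∈ cycBox p N) ∧ ∀ j k, j ≠ k → CycVisible p N (α j) (α k)}

theorem cycBox_finite (p N : ℕ) : (cycBox p N).Finite := by
  have h : (Set.pi Set.univ fun _ : Fin (p - 1) => Set.Icc (-(N : ℤ)) N).Finite :=
    Set.Finite.pi fun _ => Set.finite_Icc _ _
  refine (h.image (cycPoint p)).subset ?_
  rintro α ⟨a, ha, rfl⟩
  exact ⟨a, fun i _ => ha i, rfl⟩

/-- `Ω_K(p, N)` is finite, so that `Set.ncard` counts its elements. -/
theorem selfVisible_finite (K p N : ℕ) : (selfVisible K p N).Finite :=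
  (Set.Finite.pi fun _ : Fin K => cycBox_finite p N).subset fun _ h j _ => h.1 j

end

theorem nextCoeff_cyclotomic_prime_rat {p : ℕ} (hp : p.Prime) :
    (Polynomial.cyclotomic p ℚ).nextCoeff = 1 := by
  have := Fact.mk hp
  have h2 := hp.two_le
  have hd : (Polynomial.cyclotomic p ℚ).natDegree = p - 1 := by
    rw [Polynomial.natDegree_cyclotomic, Nat.totient_prime hp]
  rw [Polynomial.nextCoeff_of_natDegree_pos (by omega), hd, Polynomial.cyclotomic_prime,
    Polynomial.finsetSum_coeff]
  simp only [Polynomial.coeff_X_pow]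
  rw [Finset.sum_ite_eq, if_pos (Finset.mem_range.2 (by omega))]

theorem cycOmega_isPrimitiveRoot {p : ℕ} (hp : p.Prime) : IsPrimitiveRoot (cycOmega p) p := by
  have h : IsPrimitiveRoot (zetaRoot p) p := Complex.isPrimitiveRoot_exp p hp.ne_zero
  refine IsPrimitiveRoot.of_map_of_injective (f := algebraMap (CycField p) ℂ) ?_
    (algebraMap (CycField p) ℂ).injective
  rwa [cycOmega, IntermediateField.AdjoinSimple.algebraMap_gen]

theorem cycField_isCyclotomicExtension {p : ℕ} (hp : p.Prime) :
    IsCyclotomicExtension {p} ℚ (CycField p) := by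
  have : NeZero p := ⟨hp.ne_zero⟩
  have h : IsPrimitiveRoot (zetaRoot p) p := Complex.isPrimitiveRoot_exp p hp.ne_zero
  change IsCyclotomicExtension {p} ℚ (IntermediateField.adjoin ℚ {zetaRoot p}).toSubalgebra
  rw [IntermediateField.adjoin_simple_toSubalgebra_of_isAlgebraic
    ((h.isIntegral hp.pos).tower_top (A := ℚ)).isAlgebraic]
  exact h.adjoin_isCyclotomicExtension ℚ

theorem trace_cycOmega_pow {p : ℕ} (hp : p.Prime) (k : ℕ) :
    Algebra.trace ℚ (CycField p) (cycOmega p ^ k) = (if p ∣ k then (p : ℚ) else 0) - 1 := by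
  have : NeZero p := ⟨hp.ne_zero⟩
  have := cycField_isCyclotomicExtension hp
  have hω := cycOmega_isPrimitiveRoot hp
  have hirr := Polynomial.cyclotomic.irreducible_rat hp.pos
  split_ifs with hk
  · obtain ⟨l, rfl⟩ := hk
    rw [pow_mul, hω.pow_eq_one, one_pow, ← map_one (algebraMap ℚ (CycField p)),
      Algebra.trace_algebraMap, nsmul_eq_mul, mul_one,
      IsCyclotomicExtension.finrank (n := p) (CycField p) hirr, Nat.totient_prime hp, Nat.cast_pred hp.pos]
  · have hk' : IsPrimitiveRoot (cycOmega p ^ k) p :=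
      hω.pow_of_coprime k ((Nat.Prime.coprime_iff_not_dvd hp).2 hk).symm
    have h := (IsPrimitiveRoot.powerBasis (n := p) ℚ hk').trace_gen_eq_nextCoeff_minpoly
    rw [IsPrimitiveRoot.powerBasis_gen,
      ← Polynomial.cyclotomic_eq_minpoly_rat (K := CycField p) hk' hp.pos,
      nextCoeff_cyclotomic_prime_rat hp] at h
    rw [h, zero_sub]

theorem cycPsi_cycPoint {p : ℕ} (hp : p.Prime) (a : Fin (p - 1) → ℤ) (j : Fin (p - 1)) :
    cycPsi p (cycPoint p a) j = p * a j.rev - ∑ i, (a i : ℝ) := by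
  have h : Algebra.trace ℚ (CycField p) (cycPoint p a * cycOmega p ^ ((j : ℕ) + 1)) =
      p * a j.rev - ∑ i, (a i : ℚ) := by
    have h1 : cycPoint p a * cycOmega p ^ ((j : ℕ) + 1) =
        ∑ i, (a i : ℚ) • cycOmega p ^ ((i : ℕ) + 1 + (j + 1)) := by
      rw [cycPoint, Finset.sum_mul]
      refine Finset.sum_congr rfl fun i _ => ?_
      rw [mul_assoc, ← pow_add, Algebra.smul_def, map_intCast]
    have h2 : ∀ i : Fin (p - 1), (p ∣ (i : ℕ) + 1 + (j + 1)) ↔ i = j.rev := by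
      intro i
      have hi := i.2
      have hj := j.2
      rw [Fin.ext_iff, Fin.val_rev]
      constructor
      · rintro ⟨l, hl⟩
        obtain rfl : l = 1 := by
          rcases l with _ | _ | l
          · omega
          · rfl
          · have h3 : p * (l + 1 + 1) = p * l + 2 * p := by ring
            omega
        omega
      · intro h
        exact ⟨1, by omega⟩
    rw [h1, map_sum]
    simp only [map_smul, trace_cycOmega_pow hp, h2, smul_eq_mul, mul_sub, mul_one,
      Finset.sum_sub_distrib, mul_ite, mul_zero, Finset.sum_ite_eq', Finset.mem_univ, if_true]
    ring
  simp only [cycPsi]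
  rw [h]
  push_cast
  rfl

theorem cycPoint_injective {p : ℕ} (hp : p.Prime) : Function.Injective (cycPoint p) := by
  intro a b hab
  have hp0 : (p : ℝ) ≠ 0 := by exact_mod_cast hp.ne_zero
  have h : ∀ j, (p : ℝ) * (a j - b j) = ∑ i, ((a i : ℝ) - b i) := by
    intro j
    have h1 := cycPsi_cycPoint hp a j.rev
    rw [hab, cycPsi_cycPoint hp b, Fin.rev_rev] at h1
    rw [Finset.sum_sub_distrib]
    linarith
  have hs : ∑ i, ((a i : ℝ) - b i) = 0 := by
    have h1 : ∑ j, (p : ℝ) * (a j - b j) = (p - 1) * ∑ i, ((a i : ℝ) - b i) := by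
      simp only [h, Finset.sum_const, Finset.card_univ, Fintype.card_fin, nsmul_eq_mul]
      rw [Nat.cast_pred hp.pos]
    rw [← Finset.mul_sum] at h1
    linarith
  funext j
  have h2 := h j
  rw [hs, mul_eq_zero, or_iff_right hp0, sub_eq_zero] at h2
  exact_mod_cast h2

/-- The square of the cyclotomic distance as a quadratic form in the associated vectors. -/
theorem cycDist_sq {p : ℕ} (hp : p.Prime) (a b : Fin (p - 1) → ℤ) :
    cycDist p (cycPoint p a) (cycPoint p b) ^ 2 =
      (p : ℝ) ^ 2 * ∑ i, ((b i : ℝ) - a i) ^ 2 - (p + 1) * (∑ i, ((b i : ℝ) - a i)) ^ 2 := by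
  rw [cycDist, EuclideanSpace.norm_sq_eq]
  set S := ∑ i, ((b i : ℝ) - a i) with hS
  have h : ∀ j : Fin (p - 1),
      ‖(cycPsi p (cycPoint p b) - cycPsi p (cycPoint p a)) j‖ ^ 2 =
        (p * ((b j.rev : ℝ) - a j.rev) - S) ^ 2 := by
    intro j
    rw [PiLp.sub_apply, cycPsi_cycPoint hp, cycPsi_cycPoint hp, Real.norm_eq_abs, sq_abs, hS,
      Finset.sum_sub_distrib]
    ring
  simp only [h]
  rw [Fintype.sum_equiv Fin.revPerm (fun j : Fin (p - 1) => (p * ((b j.rev : ℝ) - a j.rev) - S) ^ 2)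
    (fun j => (p * ((b j : ℝ) - a j) - S) ^ 2) fun _ => rfl]
  simp only [sub_sq, mul_pow, Finset.sum_sub_distrib, Finset.sum_add_distrib, Finset.sum_const,
    Finset.card_univ, Fintype.card_fin, nsmul_eq_mul]
  rw [Nat.cast_pred hp.pos, ← Finset.mul_sum, ← Finset.sum_mul, ← Finset.mul_sum,
    ← Finset.mul_sum]
  simp only [Finset.sum_sub_distrib, Finset.sum_add_distrib] at hS ⊢
  rw [show ∑ i, (b i : ℝ) - ∑ i, (a i : ℝ) = S from hS.symm]
  ring

theorem cycDist_nonneg (p : ℕ) (α β : CycField p) : 0 ≤ cycDist p α β := norm_nonneg _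

theorem sum_neg_one_pow_fin_even {m : ℕ} (hm : Even m) : ∑ i : Fin m, (-1 : ℝ) ^ (i : ℕ) = 0 := by
  rw [Fin.sum_univ_eq_sum_range (fun i => (-1 : ℝ) ^ i), neg_one_geom_sum, if_pos hm]

theorem cycDiam_eq {p : ℕ} (hp : p.Prime) (hp2 : p ≠ 2) (N : ℕ) :
    cycDiam p N = 2 * N * p * √(p - 1) := by
  have hp1 : (0 : ℝ) ≤ (p : ℝ) - 1 := by
    have : (1 : ℝ) ≤ p := by exact_mod_cast hp.one_le
    linarith
  refine IsGreatest.csSup_eq ⟨?_, ?_⟩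
  · let a : Fin (p - 1) → ℤ := fun i => N * (-1) ^ (i : ℕ)
    have ha : ∀ i, a i ∈ Set.Icc (-(N : ℤ)) N := by
      intro i
      rcases neg_one_pow_eq_or ℤ (i : ℕ) with h | h <;> simp [a, h]
    refine ⟨cycPoint p (-a), ⟨-a, fun i => ?_, rfl⟩, cycPoint p a, ⟨a, ha, rfl⟩, ?_⟩
    · have := ha i
      simp only [Set.mem_Icc, Pi.neg_apply] at this ⊢
      omega
    · rw [← sq_eq_sq₀ (cycDist_nonneg _ _ _) (by positivity), cycDist_sq hp, mul_pow,
        Real.sq_sqrt hp1]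
      have h1 : ∀ i : Fin (p - 1), ((a i : ℝ) - (-a) i) = 2 * N * (-1) ^ (i : ℕ) := by
        intro i
        simp only [a, Pi.neg_apply]
        push_cast
        ring
      simp only [h1, ← Finset.mul_sum, mul_pow, ← pow_mul]
      rw [sum_neg_one_pow_fin_even (hp.even_sub_one hp2)]
      simp only [mul_comm _ 2, pow_mul, neg_one_sq, one_pow, Finset.sum_const, Finset.card_univ,
        Fintype.card_fin, nsmul_eq_mul]
      rw [Nat.cast_pred hp.pos]
      ring
  · rintro _ ⟨_, ⟨a, ha, rfl⟩, _, ⟨b, hb, rfl⟩, rfl⟩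
    rw [← sq_le_sq₀ (cycDist_nonneg _ _ _) (by positivity), cycDist_sq hp, mul_pow,
      Real.sq_sqrt hp1]
    have h1 : ∑ i, ((b i : ℝ) - a i) ^ 2 ≤ ∑ _i : Fin (p - 1), (2 * N : ℝ) ^ 2 := by
      refine Finset.sum_le_sum fun i _ => sq_le_sq' ?_ ?_
      · have h3 : -(2 * N : ℤ) ≤ b i - a i := by linarith [(ha i).2, (hb i).1]
        exact_mod_cast h3
      · have h3 : b i - a i ≤ (2 * N : ℤ) := by linarith [(ha i).1, (hb i).2]
        exact_mod_cast h3
    rw [Finset.sum_const, Finset.card_univ, Fintype.card_fin, nsmul_eq_mul,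
      Nat.cast_pred hp.pos] at h1
    have h2 := mul_le_mul_of_nonneg_left h1 (sq_nonneg (p : ℝ))
    have h3 : 0 ≤ ((p : ℝ) + 1) * (∑ i, ((b i : ℝ) - a i)) ^ 2 := by positivity
    linarith

/-- The second moment of a sum of independent centred copies, in counting form. -/
theorem sum_piFinset_sq_sum_of_sum_eq_zero {τ : Type*} (m : ℕ) (T : Finset τ) (f : τ → ℝ)
    (hf : ∑ t ∈ T, f t = 0) :
    (T.card : ℝ) * ∑ x ∈ Fintype.piFinset (fun _ : Fin m => T), (∑ i, f (x i)) ^ 2 =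
      m * (T.card : ℝ) ^ m * ∑ t ∈ T, f t ^ 2 := by
  have key : ∀ i j : Fin m,
      (T.card : ℝ) * ∑ x ∈ Fintype.piFinset (fun _ : Fin m => T), f (x i) * f (x j) =
        if j = i then (T.card : ℝ) ^ m * ∑ t ∈ T, f t ^ 2 else 0 := by
    intro i j
    have h1 : ∀ x : Fin m → τ, f (x i) * f (x j) =
        ∏ k, ((if k = i then f (x k) else 1) * (if k = j then f (x k) else 1)) := by
      intro x
      rw [Finset.prod_mul_distrib]
      simp
    simp only [h1]
    rw [Finset.sum_prod_piFinset T
      (fun k t => (if k = i then f t else 1) * (if k = j then f t else 1))]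
    split_ifs with hij
    · subst hij
      rw [← Finset.mul_prod_erase Finset.univ _ (Finset.mem_univ j)]
      have h2 : ∀ k ∈ Finset.univ.erase j,
          ∑ t ∈ T, ((if k = j then f t else 1) * (if k = j then f t else 1)) = (T.card : ℝ) := by
        intro k hk
        simp [(Finset.mem_erase.1 hk).1]
      rw [Finset.prod_congr rfl h2, Finset.prod_const, Finset.card_erase_of_mem (Finset.mem_univ j),
        Finset.card_univ, Fintype.card_fin]
      have hm : m = m - 1 + 1 := by have := j.2; omega
      simp only [if_true, ← sq]
      conv_rhs => rw [hm, pow_succ]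
      ring
    · rw [Finset.prod_eq_zero (Finset.mem_univ i), mul_zero]
      simp [Ne.symm hij, hf]
  simp only [sq (∑ i, f _), Finset.sum_mul_sum]
  rw [Finset.sum_comm, Finset.mul_sum]
  have h3 : ∀ i : Fin m, (T.card : ℝ) * ∑ x ∈ Fintype.piFinset (fun _ : Fin m => T),
      ∑ j, f (x i) * f (x j) = (T.card : ℝ) ^ m * ∑ t ∈ T, f t ^ 2 := by
    intro i
    rw [Finset.sum_comm, Finset.mul_sum]
    simp only [key]
    simp
  simp only [h3, Finset.sum_const, Finset.card_univ, Fintype.card_fin, nsmul_eq_mul]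
  ring

/-- Chebyshev's inequality for a sum of independent centred copies, in counting form. -/
theorem card_filter_mul_sq_le {τ : Type*} (m : ℕ) (T : Finset τ) (hT : T.Nonempty) (f : τ → ℝ)
    (hf : ∑ t ∈ T, f t = 0) {B : ℝ} (hB : ∀ t ∈ T, f t ^ 2 ≤ B) (P : (Fin m → τ) → Prop)
    [DecidablePred P] {r : ℝ} (hP : ∀ x, P x → r ≤ (∑ i, f (x i)) ^ 2) :
    (((Fintype.piFinset fun _ : Fin m => T).filter P).card : ℝ) * r ≤
      m * (T.card : ℝ) ^ m * B := by
  have hc : (0 : ℝ) < T.card := by exact_mod_cast hT.card_pos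
  have h1 : (((Fintype.piFinset fun _ : Fin m => T).filter P).card : ℝ) * r ≤
      ∑ x ∈ Fintype.piFinset (fun _ : Fin m => T), (∑ i, f (x i)) ^ 2 := by
    rw [← nsmul_eq_mul]
    refine (Finset.card_nsmul_le_sum _ _ _ fun x hx => hP x (Finset.mem_filter.1 hx).2).trans ?_
    exact Finset.sum_le_sum_of_subset_of_nonneg (Finset.filter_subset _ _)
      fun _ _ _ => sq_nonneg _
  have h2 : ∑ t ∈ T, f t ^ 2 ≤ T.card * B := by
    rw [← nsmul_eq_mul]
    exact Finset.sum_le_card_nsmul _ _ _ hB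
  have h3 := sum_piFinset_sq_sum_of_sum_eq_zero m T f hf
  refine le_of_mul_le_mul_left ?_ hc
  calc (T.card : ℝ) * ((((Fintype.piFinset fun _ : Fin m => T).filter P).card : ℝ) * r)
      ≤ _ := mul_le_mul_of_nonneg_left h1 hc.le
    _ = _ := h3
    _ ≤ m * (T.card : ℝ) ^ m * (T.card * B) := mul_le_mul_of_nonneg_left h2 (by positivity)
    _ = _ := by ring

/-- The integers of absolute value at most `N`. -/
noncomputable abbrev symIcc (N : ℕ) : Finset ℤ := Finset.Icc (-(N : ℤ)) N

theorem card_symIcc (N : ℕ) : (symIcc N).card = 2 * N + 1 := by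
  rw [Int.card_Icc]
  omega

theorem sum_symIcc_succ (N : ℕ) (f : ℤ → ℝ) :
    ∑ a ∈ symIcc (N + 1), f a = f (-(N + 1)) + f (N + 1) + ∑ a ∈ symIcc N, f a := by
  have h : symIcc (N + 1) = insert (-((N : ℤ) + 1)) (insert ((N : ℤ) + 1) (symIcc N)) := by
    ext x
    simp only [Finset.mem_insert, Finset.mem_Icc]
    push_cast
    omega
  rw [h, Finset.sum_insert, Finset.sum_insert, add_assoc]
  · simp only [Finset.mem_Icc]
    omega
  · simp only [Finset.mem_insert, Finset.mem_Icc]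
    omega

theorem sum_symIcc_id (N : ℕ) : ∑ a ∈ symIcc N, (a : ℝ) = 0 := by
  induction N with
  | zero => simp [symIcc]
  | succ N ih =>
    rw [sum_symIcc_succ N (fun a => (a : ℝ)), ih]
    push_cast
    ring

theorem sum_symIcc_sq (N : ℕ) :
    ∑ a ∈ symIcc N, (a : ℝ) ^ 2 = N * (N + 1) * (2 * N + 1) / 3 := by
  induction N with
  | zero => simp [symIcc]
  | succ N ih =>
    rw [sum_symIcc_succ N (fun a => (a : ℝ) ^ 2), ih]
    push_cast
    ring

theorem sum_symIcc_prod_sub (N : ℕ) :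
    ∑ t ∈ symIcc N ×ˢ symIcc N, ((t.2 : ℝ) - t.1) = 0 := by
  rw [Finset.sum_product]
  simp only [Finset.sum_sub_distrib, Finset.sum_const, sum_symIcc_id]
  rw [← Finset.smul_sum, sum_symIcc_id]
  simp

theorem sum_symIcc_prod_sub_sq (N : ℕ) :
    ∑ t ∈ symIcc N ×ˢ symIcc N, (((t.2 : ℝ) - t.1) ^ 2 - 2 * N * (N + 1) / 3) = 0 := by
  rw [Finset.sum_product]
  have h : ∀ a b : ℤ, ((b : ℝ) - a) ^ 2 - 2 * N * (N + 1) / 3 =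
      (b : ℝ) ^ 2 - 2 * a * b + (a ^ 2 - 2 * N * (N + 1) / 3) := by
    intro a b
    ring
  simp only [h, Finset.sum_add_distrib, Finset.sum_sub_distrib, Finset.sum_const, sum_symIcc_id,
    sum_symIcc_sq, ← Finset.mul_sum, card_symIcc, nsmul_eq_mul]
  rw [← Finset.sum_mul, ← Finset.mul_sum, sum_symIcc_id]
  push_cast
  ring

theorem abs_sub_le_of_mem {N : ℕ} {t : ℤ × ℤ} (ht : t ∈ symIcc N ×ˢ symIcc N) :
    |(t.2 : ℝ) - t.1| ≤ 2 * N := by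
  simp only [Finset.mem_product, Finset.mem_Icc] at ht
  rw [abs_le]
  constructor
  · have : -(2 * N : ℤ) ≤ t.2 - t.1 := by omega
    exact_mod_cast this
  · have : t.2 - t.1 ≤ (2 * N : ℤ) := by omega
    exact_mod_cast this

/-- The pairs in the square of side `2N + 1` whose coordinates are congruent modulo `q`. -/
theorem card_filter_dvd_sub_le (N : ℕ) {q : ℕ} (hq : 0 < q) :
    (((symIcc N ×ˢ symIcc N).filter fun t => (q : ℤ) ∣ t.2 - t.1).card : ℝ) ≤
      (2 * N + 1) * ((2 * N + 1) / q + 1) := by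
  have hq' : (0 : ℤ) < q := by exact_mod_cast hq
  rw [Finset.card_filter, Finset.sum_product]
  simp only [← Finset.card_filter]
  have h : ∀ a ∈ symIcc N, ((((symIcc N).filter fun b => (q : ℤ) ∣ b - a).card : ℕ) : ℝ) ≤
      (2 * N + 1) / q + 1 := by
    intro a _
    have h1 : ((symIcc N).filter fun b => (q : ℤ) ∣ b - a) =
        (Finset.Ico (-(N : ℤ)) (N + 1)).filter fun b => b ≡ a [ZMOD q] := by
      ext b
      simp only [Finset.mem_filter, Finset.mem_Icc, Finset.mem_Ico,
        Int.modEq_iff_dvd, dvd_sub_comm (a := (q : ℤ)) (b := a), Int.lt_add_one_iff]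
    have h2 := Int.Ico_filter_modEq_card (-(N : ℤ)) (N + 1) hq' a
    rw [h1]
    have h3 : (((Finset.Ico (-(N : ℤ)) (N + 1)).filter fun b => b ≡ a [ZMOD q]).card : ℚ) ≤
        (2 * N + 1) / q + 1 := by
      have h4 : (((Finset.Ico (-(N : ℤ)) (N + 1)).filter fun b => b ≡ a [ZMOD q]).card : ℚ) =
        (((Finset.Ico (-(N : ℤ)) (N + 1)).filter fun b => b ≡ a [ZMOD q]).card : ℤ) := by simp
      rw [h4, h2]
      push_cast
      refine max_le ?_ (by positivity)
      have h5 := Int.ceil_lt_add_one (((N : ℚ) + 1 - a) / q)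
      have h6 := Int.le_ceil ((-(N : ℚ) - a) / q)
      have h7 : ((2 * N + 1 : ℚ)) / q = ((N : ℚ) + 1 - a) / q - (-(N : ℚ) - a) / q := by ring
      linarith
    have h8 := (Rat.cast_le (K := ℝ)).2 h3
    push_cast at h8
    exact h8
  push_cast
  refine (Finset.sum_le_card_nsmul _ _ _ h).trans ?_
  rw [card_symIcc, nsmul_eq_mul]
  push_cast
  rfl

open Classical in
/-- The number of families in a finite set `A` of integer vectors two of whose members are related
is controlled by the number of related pairs. -/
theorem card_piFinset_filter_rel_mul_le {ι : Type*} [Fintype ι] [DecidableEq ι] (m : ℕ)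
    (S : Finset ℤ) (R : (Fin m → ℤ) → (Fin m → ℤ) → Prop) {j k : ι} (hjk : j ≠ k) :
    ((Fintype.piFinset fun _ : ι => Fintype.piFinset fun _ : Fin m => S).filter
        fun α => R (α j) (α k)).card * (Fintype.piFinset fun _ : Fin m => S ×ˢ S).card ≤
      ((Fintype.piFinset fun _ : Fin m => S ×ˢ S).filter
        fun x => R (fun i => (x i).1) (fun i => (x i).2)).card *
        (Fintype.piFinset fun _ : ι => Fintype.piFinset fun _ : Fin m => S).card := by
  rw [← Finset.card_product, ← Finset.card_product]
  refine Finset.card_le_card_of_injOn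
    (fun y => ((fun i => (y.1 j i, y.1 k i)),
      Function.update (Function.update y.1 j fun i => (y.2 i).1) k fun i => (y.2 i).2)) ?_ ?_
  · rintro ⟨α, x⟩ h
    simp only [Finset.coe_product, Set.mem_prod, Finset.mem_coe, Finset.mem_filter,
      Fintype.mem_piFinset, Finset.mem_product] at h ⊢
    obtain ⟨⟨hα, hR⟩, hx⟩ := h
    refine ⟨⟨fun i => ⟨hα j i, hα k i⟩, hR⟩, fun l i => ?_⟩
    by_cases hl : l = k
    · subst hl
      simpa using (hx i).2
    · rw [Function.update_of_ne hl]
      by_cases hl' : l = j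
      · subst hl'
        simpa using (hx i).1
      · rw [Function.update_of_ne hl']
        exact hα l i
  · rintro ⟨α, x⟩ _ ⟨β, y⟩ _ h
    simp only [Prod.mk.injEq] at h
    obtain ⟨h1, h2⟩ := h
    have hj : ∀ i, α j i = β j i := fun i => (Prod.ext_iff.1 (congrFun h1 i)).1
    have hk : ∀ i, α k i = β k i := fun i => (Prod.ext_iff.1 (congrFun h1 i)).2
    have hx2 : ∀ i, (x i).2 = (y i).2 := fun i => by
      have := congrFun (congrFun h2 k) i
      simpa using this
    have hx1 : ∀ i, (x i).1 = (y i).1 := fun i => by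
      have := congrFun (congrFun h2 j) i
      simpa [Function.update_of_ne hjk] using this
    refine Prod.ext (funext fun l => funext fun i => ?_)
      (funext fun i => Prod.ext (hx1 i) (hx2 i))
    by_cases hl : l = k
    · rw [hl]
      exact hk i
    by_cases hl' : l = j
    · rw [hl']
      exact hj i
    have := congrFun (congrFun h2 l) i
    simpa [Function.update_of_ne hl, Function.update_of_ne hl'] using this

open Classical in
/-- A union bound: few related pairs give few families containing a related pair. -/
theorem card_piFinset_filter_exists_rel_le {ι : Type*} [Fintype ι] [DecidableEq ι] (m : ℕ)
    (S : Finset ℤ) (hS : S.Nonempty) (R : (Fin m → ℤ) → (Fin m → ℤ) → Prop) {δ : ℝ}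
    (hδ : (((Fintype.piFinset fun _ : Fin m => S ×ˢ S).filter
        fun x => R (fun i => (x i).1) (fun i => (x i).2)).card : ℝ) ≤
      δ * ((S ×ˢ S).card : ℝ) ^ m) :
    (((Fintype.piFinset fun _ : ι => Fintype.piFinset fun _ : Fin m => S).filter
        fun α => ∃ j k, j ≠ k ∧ R (α j) (α k)).card : ℝ) ≤
      (Fintype.card ι : ℝ) ^ 2 * δ *
        (Fintype.piFinset fun _ : ι => Fintype.piFinset fun _ : Fin m => S).card := by
  set A := Fintype.piFinset fun _ : ι => Fintype.piFinset fun _ : Fin m => S with hA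
  have hc : (0 : ℝ) < ((S ×ˢ S).card : ℝ) ^ m := by
    have := (hS.product hS).card_pos
    positivity
  have hδ0 : 0 ≤ δ := by
    by_contra! h
    have := mul_neg_of_neg_of_pos h hc
    have h2 : (0 : ℝ) ≤ (((Fintype.piFinset fun _ : Fin m => S ×ˢ S).filter
        fun x => R (fun i => (x i).1) (fun i => (x i).2)).card : ℝ) := Nat.cast_nonneg _
    linarith
  have h1 : ∀ jk : ι × ι, ((A.filter fun α => jk.1 ≠ jk.2 ∧ R (α jk.1) (α jk.2)).card : ℝ) ≤
      δ * A.card := by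
    rintro ⟨j, k⟩
    by_cases hjk : j = k
    · simp only [hjk, ne_eq, not_true_eq_false, false_and, Finset.filter_false, Finset.card_empty,
        Nat.cast_zero]
      positivity
    · simp only [ne_eq, hjk, not_false_eq_true, true_and]
      have h2 := card_piFinset_filter_rel_mul_le m S R hjk
      rw [Fintype.card_piFinset_const (S ×ˢ S) m] at h2
      have h3 : ((A.filter fun α => R (α j) (α k)).card : ℝ) * ((S ×ˢ S).card : ℝ) ^ m ≤
          (((Fintype.piFinset fun _ : Fin m => S ×ˢ S).filter
            fun x => R (fun i => (x i).1) (fun i => (x i).2)).card : ℝ) * A.card := by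
        exact_mod_cast h2
      refine le_of_mul_le_mul_right ?_ hc
      have h4 := mul_le_mul_of_nonneg_right hδ (Nat.cast_nonneg (α := ℝ) A.card)
      linarith
  have h5 : (A.filter fun α => ∃ j k, j ≠ k ∧ R (α j) (α k)) ⊆
      Finset.univ.biUnion fun jk : ι × ι =>
        A.filter fun α => jk.1 ≠ jk.2 ∧ R (α jk.1) (α jk.2) := by
    intro α h
    obtain ⟨hα, j, k, h⟩ := Finset.mem_filter.1 h
    exact Finset.mem_biUnion.2 ⟨(j, k), Finset.mem_univ _, Finset.mem_filter.2 ⟨hα, h⟩⟩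
  calc ((A.filter fun α => ∃ j k, j ≠ k ∧ R (α j) (α k)).card : ℝ)
      ≤ ((∑ jk : ι × ι, (A.filter fun α => jk.1 ≠ jk.2 ∧ R (α jk.1) (α jk.2)).card : ℕ) : ℝ) := by
        exact_mod_cast (Finset.card_le_card h5).trans Finset.card_biUnion_le
    _ ≤ ∑ _jk : ι × ι, δ * A.card := by
        push_cast
        exact Finset.sum_le_sum fun jk _ => h1 jk
    _ = _ := by
        rw [Finset.sum_const, Finset.card_univ, Fintype.card_prod, nsmul_eq_mul]
        push_cast
        ring

theorem exists_dvd_sub_of_not_cycVisible {p : ℕ} (hp : p.Prime) {N : ℕ} {a b : Fin (p - 1) → ℤ}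
    (ha : ∀ i, a i ∈ symIcc N) (hb : ∀ i, b i ∈ symIcc N)
    (h : ¬ CycVisible p N (cycPoint p a) (cycPoint p b)) :
    ∃ q ∈ Finset.Ioc 1 (2 * N), ∀ i, (q : ℤ) ∣ b i - a i := by
  simp only [CycVisible, not_forall] at h
  obtain ⟨a', b', c, ha', hb', -, hc, hne⟩ := h
  obtain rfl := cycPoint_injective hp ha'
  obtain rfl := cycPoint_injective hp hb'
  rw [not_or] at hne
  rw [segment_eq_image'] at hc
  obtain ⟨t, ⟨ht0, ht1⟩, htc⟩ := hc
  have htc : ∀ i, (a' i : ℝ) + t * (b' i - a' i) = c i := fun i => by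
    have := congrFun htc i
    simpa using this
  obtain ⟨i₀, hi₀⟩ : ∃ i, b' i - a' i ≠ 0 := by
    by_contra! h
    refine hne.1 (funext fun i => ?_)
    have h1 := htc i
    have h2 : (b' i : ℝ) - a' i = 0 := by exact_mod_cast h i
    rw [h2, mul_zero, add_zero] at h1
    exact_mod_cast h1.symm
  set D := b' i₀ - a' i₀ with hD
  set E := c i₀ - a' i₀ with hE
  have htE : t * D = E := by
    have := htc i₀
    rw [hD, hE]
    push_cast
    linarith
  have hi : ∀ i, D * (c i - a' i) = E * (b' i - a' i) := by
    intro i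
    have h1 : (D : ℝ) * (c i - a' i) = E * (b' i - a' i) := by
      rw [← htE, ← htc i]
      ring
    exact_mod_cast h1
  obtain ⟨D', hD'⟩ : (Int.gcd D E : ℤ) ∣ D := Int.gcd_dvd_left ..
  obtain ⟨E', hE'⟩ : (Int.gcd D E : ℤ) ∣ E := Int.gcd_dvd_right ..
  have hg : (Int.gcd D E : ℤ) ≠ 0 := by
    intro h
    rw [h, zero_mul] at hD'
    exact hi₀ hD'
  have hcop : IsCoprime D' E' := by
    have hpos : 0 < Int.gcd D E := Nat.pos_of_ne_zero (by exact_mod_cast hg)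
    have h1 := Int.gcd_ediv_gcd_ediv_gcd hpos
    rw [Int.isCoprime_iff_gcd_eq_one]
    have h2 : D / (Int.gcd D E : ℤ) = D' := Int.ediv_eq_of_eq_mul_right hg hD'
    have h3 : E / (Int.gcd D E : ℤ) = E' := Int.ediv_eq_of_eq_mul_right hg hE'
    rwa [h2, h3] at h1
  have hdvd : ∀ i, D' ∣ b' i - a' i := by
    intro i
    refine hcop.dvd_of_dvd_mul_left ⟨c i - a' i, ?_⟩
    apply mul_left_cancel₀ hg
    linear_combination -hi i + (c i - a' i) * hD' - (b' i - a' i) * hE'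
  have hD'0 : D' ≠ 0 := by
    rintro rfl
    rw [mul_zero] at hD'
    exact hi₀ hD'
  refine ⟨D'.natAbs, Finset.mem_Ioc.2 ⟨?_, ?_⟩, fun i => Int.natAbs_dvd.2 (hdvd i)⟩
  · by_contra! hle
    have h1 : D'.natAbs = 1 := by have := Int.natAbs_pos.2 hD'0; omega
    have hDE : D ∣ E := by
      have h2 := mul_dvd_mul_left (Int.gcd D E : ℤ)
        ((Int.isUnit_iff_natAbs_eq.2 h1).dvd (a := E'))
      rwa [← hD', ← hE'] at h2
    obtain ⟨l, hl⟩ := hDE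
    have htl : t = l := by
      have hD0 : (D : ℝ) ≠ 0 := by exact_mod_cast hi₀
      rw [hl] at htE
      push_cast at htE
      rw [mul_comm (D : ℝ)] at htE
      exact mul_right_cancel₀ hD0 htE
    have hl0 : 0 ≤ l := by rw [htl] at ht0; exact_mod_cast ht0
    have hl1 : l ≤ 1 := by rw [htl] at ht1; exact_mod_cast ht1
    obtain rfl | rfl : l = 0 ∨ l = 1 := by omega
    · refine hne.1 (funext fun i => ?_)
      have h2 := htc i
      rw [htl] at h2
      push_cast at h2
      have h3 : (c i : ℝ) = a' i := by linarith
      exact_mod_cast h3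
    · refine hne.2 (funext fun i => ?_)
      have h2 := htc i
      rw [htl] at h2
      push_cast at h2
      have h3 : (c i : ℝ) = b' i := by linarith
      exact_mod_cast h3
  · have h1 : D'.natAbs ≤ D.natAbs :=
      Int.natAbs_le_of_dvd_ne_zero (Dvd.intro_left _ hD'.symm) hi₀
    have h2 := Finset.mem_Icc.1 (ha i₀)
    have h3 := Finset.mem_Icc.1 (hb i₀)
    omega

open Classical in
theorem card_exists_dvd_sub_le {m N : ℕ} (hm : 2 ≤ m) (hN : 2 ≤ N) :
    (((Fintype.piFinset fun _ : Fin m => symIcc N ×ˢ symIcc N).filter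
        fun x => ∃ q ∈ Finset.Ioc 1 (2 * N), ∀ i, (q : ℤ) ∣ (x i).2 - (x i).1).card : ℝ) ≤
      8 * (3 / 4) ^ m * ((symIcc N ×ˢ symIcc N).card : ℝ) ^ m := by
  have hN' : (2 : ℝ) ≤ N := by exact_mod_cast hN
  have hc : ((symIcc N ×ˢ symIcc N).card : ℝ) = (2 * N + 1) ^ 2 := by
    rw [Finset.card_product, card_symIcc]
    push_cast
    ring
  have h1 : ∀ q ∈ Finset.Ioc 1 (2 * N), (((Fintype.piFinset fun _ : Fin m =>
      symIcc N ×ˢ symIcc N).filter fun x => ∀ i, (q : ℤ) ∣ (x i).2 - (x i).1).card : ℝ) ≤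
      8 * (3 / 4) ^ m * ((2 * N + 1) ^ 2) ^ m * ((q : ℝ) ^ 2)⁻¹ := by
    intro q hq
    obtain ⟨hq1, hq2⟩ := Finset.mem_Ioc.1 hq
    have hq1' : (2 : ℝ) ≤ q := by exact_mod_cast hq1
    have hq2' : (q : ℝ) ≤ 2 * N := by exact_mod_cast hq2
    have h2 : ((Fintype.piFinset fun _ : Fin m => symIcc N ×ˢ symIcc N).filter
        fun x => ∀ i, (q : ℤ) ∣ (x i).2 - (x i).1) = Fintype.piFinset fun _ : Fin m =>
          (symIcc N ×ˢ symIcc N).filter fun t => (q : ℤ) ∣ t.2 - t.1 := by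
      ext x
      simp only [Finset.mem_filter, Fintype.mem_piFinset, forall_and]
    rw [h2, Fintype.card_piFinset_const]
    push_cast
    set r : ℝ := 1 / q + 1 / (2 * N + 1) with hr
    have hr0 : 0 ≤ r := by positivity
    have hr1 : r ≤ 3 / 4 := by
      have h3 : 1 / (q : ℝ) ≤ 1 / 2 := one_div_le_one_div_of_le (by norm_num) hq1'
      have h4 : 1 / (2 * (N : ℝ) + 1) ≤ 1 / 4 :=
        one_div_le_one_div_of_le (by norm_num) (by linarith)
      linarith
    have hr2 : r ≤ 2 / q := by
      have h3 : 1 / (2 * (N : ℝ) + 1) ≤ 1 / q :=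
        one_div_le_one_div_of_le (by linarith) (by linarith)
      have h4 : (2 : ℝ) / q = 1 / q + 1 / q := by ring
      linarith
    have h5 : (2 * (N : ℝ) + 1) * ((2 * N + 1) / q + 1) = (2 * N + 1) ^ 2 * r := by
      rw [hr]
      field_simp
    have h6 : r ^ m ≤ (3 / 4) ^ (m - 2) * (2 / q) ^ 2 := by
      conv_lhs => rw [show m = m - 2 + 2 by omega, pow_add]
      gcongr
    have h7 : ((3 : ℝ) / 4) ^ m = (3 / 4) ^ (m - 2) * (3 / 4) ^ 2 := by
      rw [← pow_add, show m - 2 + 2 = m by omega]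
    have h8 : r ^ m ≤ 8 * (3 / 4) ^ m * ((q : ℝ) ^ 2)⁻¹ := by
      refine h6.trans ?_
      rw [h7, div_pow 2, div_eq_mul_inv ((2 : ℝ) ^ 2), ← mul_assoc]
      refine mul_le_mul_of_nonneg_right ?_ (by positivity)
      have : (0 : ℝ) ≤ (3 / 4) ^ (m - 2) := by positivity
      linarith
    calc _ ≤ ((2 * (N : ℝ) + 1) * ((2 * N + 1) / q + 1)) ^ m :=
          pow_le_pow_left₀ (Nat.cast_nonneg _) (card_filter_dvd_sub_le N (by omega)) m
      _ = ((2 * (N : ℝ) + 1) ^ 2) ^ m * r ^ m := by rw [h5, mul_pow]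
      _ ≤ ((2 * (N : ℝ) + 1) ^ 2) ^ m * (8 * (3 / 4) ^ m * ((q : ℝ) ^ 2)⁻¹) := by gcongr
      _ = _ := by ring
  have h9 : ((Fintype.piFinset fun _ : Fin m => symIcc N ×ˢ symIcc N).filter
        fun x => ∃ q ∈ Finset.Ioc 1 (2 * N), ∀ i, (q : ℤ) ∣ (x i).2 - (x i).1) ⊆
      (Finset.Ioc 1 (2 * N)).biUnion fun q => (Fintype.piFinset fun _ : Fin m =>
        symIcc N ×ˢ symIcc N).filter fun x => ∀ i, (q : ℤ) ∣ (x i).2 - (x i).1 := by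
    intro x hx
    obtain ⟨hx, q, hq, h⟩ := Finset.mem_filter.1 hx
    exact Finset.mem_biUnion.2 ⟨q, hq, Finset.mem_filter.2 ⟨hx, h⟩⟩
  have h10 := (Finset.card_le_card h9).trans Finset.card_biUnion_le
  have h11 : ∑ q ∈ Finset.Ioc 1 (2 * N), ((q : ℝ) ^ 2)⁻¹ ≤ 1 := by
    refine (sum_Ioc_inv_sq_le_sub one_ne_zero (by omega)).trans ?_
    have : (0 : ℝ) ≤ ((2 * N : ℕ) : ℝ)⁻¹ := by positivity
    simp only [Nat.cast_one, inv_one]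
    linarith
  rw [hc]
  refine (Nat.cast_le.2 h10).trans ?_
  push_cast
  refine (Finset.sum_le_sum h1).trans ?_
  rw [← Finset.mul_sum]
  exact mul_le_of_le_one_right (by positivity) h11

theorem eight_mul_pow_le {m K : ℕ} (hK : 0 < K) (hm : 48 * K ^ 2 ≤ m) :
    8 * (3 / 4 : ℝ) ^ m ≤ 1 / (2 * K ^ 2) := by
  have hK' : (0 : ℝ) < K := by exact_mod_cast hK
  have hm' : 48 * (K : ℝ) ^ 2 ≤ m := by exact_mod_cast hm
  have h1 : 1 + (m : ℝ) * (1 / 3) ≤ (1 + 1 / 3) ^ m := one_add_mul_le_pow (by norm_num) m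
  have h2 : (3 / 4 : ℝ) ^ m * (1 + 1 / 3) ^ m = 1 := by
    rw [← mul_pow]
    norm_num
  rw [le_div_iff₀ (by positivity)]
  have h3 : 16 * (K : ℝ) ^ 2 ≤ (1 + 1 / 3) ^ m := by linarith
  have h4 := mul_le_mul_of_nonneg_left h3 (show (0 : ℝ) ≤ (3 / 4) ^ m by positivity)
  linarith

open Classical in
/-- The normalized squared distance of two random points of the box is concentrated near `1/6`. -/
theorem card_abs_sub_one_sixth_le {p n K N : ℕ} (hn : 0 < n) (hK : 0 < K)
    (hp : 200 * n ^ 3 * K ^ 2 < p) (hN : n ≤ N) :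
    (((Fintype.piFinset fun _ : Fin (p - 1) => symIcc N ×ˢ symIcc N).filter fun x =>
        1 / (3 * n : ℝ) < |((p : ℝ) ^ 2 * ∑ i, (((x i).2 : ℝ) - (x i).1) ^ 2 -
          (p + 1) * (∑ i, (((x i).2 : ℝ) - (x i).1)) ^ 2) / (2 * N * p * √(p - 1)) ^ 2 -
            1 / 6|).card : ℝ) ≤
      1 / (2 * n * K ^ 2) * ((symIcc N ×ˢ symIcc N).card : ℝ) ^ (p - 1) := by
  have hn' : (1 : ℝ) ≤ n := by exact_mod_cast hn
  have hK' : (1 : ℝ) ≤ K := by exact_mod_cast hK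
  have hN' : (n : ℝ) ≤ N := by exact_mod_cast hN
  have hN0 : (0 : ℝ) < N := by linarith
  obtain ⟨m, rfl⟩ : ∃ m, p = m + 1 := ⟨p - 1, by omega⟩
  have hm' : 200 * (n : ℝ) ^ 3 * K ^ 2 ≤ m := by exact_mod_cast Nat.lt_succ_iff.1 hp
  have hm0 : (0 : ℝ) < m := lt_of_lt_of_le (by positivity) hm'
  simp only [Nat.add_sub_cancel]
  push_cast
  set T := symIcc N ×ˢ symIcc N with hT
  have hTne : T.Nonempty := ⟨(0, 0), by simp [hT]⟩
  set W : ℝ := (T.card : ℝ) ^ m with hW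
  have hW0 : 0 ≤ W := by positivity
  have hsq : ((2 : ℝ) * N * (m + 1) * √((m : ℝ) + 1 - 1)) ^ 2 = 4 * N ^ 2 * (m + 1) ^ 2 * m := by
    rw [mul_pow, Real.sq_sqrt (by linarith)]
    ring
  rw [hsq]
  let f₁ : ℤ × ℤ → ℝ := fun t => ((t.2 : ℝ) - t.1) ^ 2 - 2 * N * (N + 1) / 3
  let f₂ : ℤ × ℤ → ℝ := fun t => (t.2 : ℝ) - t.1
  let r₁ : ℝ := (4 * N ^ 2 * m / (9 * n)) ^ 2
  let r₂ : ℝ := 4 * N ^ 2 * (m + 1) ^ 2 * m / (9 * n * (m + 2))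
  have hf₂ : ∀ t ∈ T, f₂ t ^ 2 ≤ 4 * N ^ 2 := by
    intro t ht
    have h := abs_sub_le_of_mem ht
    have h2 := pow_le_pow_left₀ (abs_nonneg _) h 2
    rw [sq_abs] at h2
    calc _ ≤ _ := h2
      _ = _ := by ring
  have hf₁ : ∀ t ∈ T, f₁ t ^ 2 ≤ (4 * N ^ 2) ^ 2 := by
    intro t ht
    have h := hf₂ t ht
    have h0 : 0 ≤ f₂ t ^ 2 := sq_nonneg _
    have h1 : (2 : ℝ) * N * (N + 1) / 3 ≤ 4 * N ^ 2 := by nlinarith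
    have h2 : (0 : ℝ) ≤ 2 * N * (N + 1) / 3 := by positivity
    have h3 : f₁ t = f₂ t ^ 2 - 2 * N * (N + 1) / 3 := rfl
    rw [h3]
    exact sq_le_sq' (by linarith) (by linarith)
  have c₁ := card_filter_mul_sq_le m T hTne f₁ (sum_symIcc_prod_sub_sq N) hf₁
    (fun x => r₁ ≤ (∑ i, f₁ (x i)) ^ 2) (r := r₁) fun _ h => h
  have c₂ := card_filter_mul_sq_le m T hTne f₂ (sum_symIcc_prod_sub N) hf₂
    (fun x => r₂ ≤ (∑ i, f₂ (x i)) ^ 2) (r := r₂) fun _ h => h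
  rw [← hW] at c₁ c₂
  set k₁ : ℝ := (((Fintype.piFinset fun _ : Fin m => T).filter
    fun x => r₁ ≤ (∑ i, f₁ (x i)) ^ 2).card : ℝ)
  set k₂ : ℝ := (((Fintype.piFinset fun _ : Fin m => T).filter
    fun x => r₂ ≤ (∑ i, f₂ (x i)) ^ 2).card : ℝ)
  have d₁ : k₁ ≤ 81 * n ^ 2 / m * W := by
    refine le_of_mul_le_mul_right (c₁.trans (le_of_eq ?_)) (show 0 < r₁ by positivity)
    simp only [r₁]
    field_simp
    norm_num
  have d₂ : k₂ ≤ 18 * n / m * W := by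
    have h1 : k₂ ≤ 9 * n * (m + 2) / (m + 1) ^ 2 * W := by
      refine le_of_mul_le_mul_right (c₂.trans (le_of_eq ?_)) (show 0 < r₂ by positivity)
      simp only [r₂]
      field_simp
    refine h1.trans (mul_le_mul_of_nonneg_right ?_ hW0)
    rw [div_le_div_iff₀ (by positivity) hm0]
    have : ((m : ℝ) + 2) * m ≤ 2 * (m + 1) ^ 2 := by nlinarith
    have h3 := mul_le_mul_of_nonneg_left this (show (0 : ℝ) ≤ 9 * n by positivity)
    linarith
  have hsub : ((Fintype.piFinset fun _ : Fin m => T).filter fun x =>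
        1 / (3 * n : ℝ) < |(((m : ℝ) + 1) ^ 2 * ∑ i, (((x i).2 : ℝ) - (x i).1) ^ 2 -
          (m + 1 + 1) * (∑ i, (((x i).2 : ℝ) - (x i).1)) ^ 2) / (4 * N ^ 2 * (m + 1) ^ 2 * m) -
            1 / 6|) ⊆
      ((Fintype.piFinset fun _ : Fin m => T).filter fun x => r₁ ≤ (∑ i, f₁ (x i)) ^ 2) ∪
      ((Fintype.piFinset fun _ : Fin m => T).filter fun x => r₂ ≤ (∑ i, f₂ (x i)) ^ 2) := by
    intro x hx
    rw [← Finset.filter_or]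
    obtain ⟨hxT, hx⟩ := Finset.mem_filter.1 hx
    refine Finset.mem_filter.2 ⟨hxT, ?_⟩
    by_contra! hcon
    obtain ⟨h1, h2⟩ := hcon
    refine absurd hx (not_lt.2 ?_)
    set F := ∑ i, f₁ (x i) with hF
    set S := ∑ i, f₂ (x i) with hS
    have hQ : ∑ i, (((x i).2 : ℝ) - (x i).1) ^ 2 = F + m * (2 * N * (N + 1) / 3) := by
      simp only [hF, f₁, Finset.sum_sub_distrib, Finset.sum_const, Finset.card_univ,
        Fintype.card_fin, nsmul_eq_mul]
      ring
    rw [hQ]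
    have e : (((m : ℝ) + 1) ^ 2 * (F + m * (2 * N * (N + 1) / 3)) - (m + 1 + 1) * S ^ 2) /
        (4 * N ^ 2 * (m + 1) ^ 2 * m) - 1 / 6 =
        F / (4 * N ^ 2 * m) + 1 / (6 * N) - S ^ 2 / (4 * N ^ 2 * (m + 1) ^ 2 * m / (m + 2)) := by
      field_simp
      ring
    have b₁ : |F / (4 * N ^ 2 * m)| ≤ 1 / (9 * n : ℝ) := by
      have h3 : |F| ≤ 4 * N ^ 2 * m / (9 * n) := abs_le_of_sq_le_sq h1.le (by positivity)
      rw [abs_div, abs_of_pos (show (0 : ℝ) < 4 * N ^ 2 * m by positivity),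
        div_le_iff₀ (by positivity)]
      calc _ ≤ _ := h3
        _ = _ := by ring
    have b₂ : S ^ 2 / (4 * N ^ 2 * (m + 1) ^ 2 * m / (m + 2)) ≤ 1 / (9 * n) := by
      rw [div_le_iff₀ (by positivity)]
      calc _ ≤ _ := h2.le
        _ = _ := by
          simp only [r₂]
          field_simp
    have b₃ : 0 ≤ S ^ 2 / (4 * N ^ 2 * (m + 1) ^ 2 * m / (m + 2)) := by positivity
    have b₄ : 1 / (6 * N : ℝ) ≤ 1 / (6 * n) :=
      one_div_le_one_div_of_le (by positivity) (by linarith)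
    have b₅ : 0 ≤ 1 / (6 * N : ℝ) := by positivity
    have b₆ : 1 / (9 * n : ℝ) = 1 / 9 * (1 / n) := by field_simp
    have b₇ : 1 / (6 * n : ℝ) = 1 / 6 * (1 / n) := by field_simp
    have b₈ : 1 / (3 * n : ℝ) = 1 / 3 * (1 / n) := by field_simp
    have b₉ : 0 < 1 / (n : ℝ) := by positivity
    obtain ⟨b₁, b₁'⟩ := abs_le.1 b₁
    rw [e, abs_le]
    constructor <;> linarith
  calc _ ≤ ((_ : ℕ) : ℝ) := Nat.cast_le.2 ((Finset.card_le_card hsub).trans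
        (Finset.card_union_le _ _))
    _ = k₁ + k₂ := by push_cast; rfl
    _ ≤ 81 * n ^ 2 / m * W + 18 * n / m * W := add_le_add d₁ d₂
    _ = (81 * n ^ 2 + 18 * n) / m * W := by ring
    _ ≤ 1 / (2 * n * K ^ 2) * W := by
      refine mul_le_mul_of_nonneg_right ?_ hW0
      rw [div_le_div_iff₀ hm0 (by positivity)]
      have h1 : (n : ℝ) ≤ n ^ 2 := by nlinarith
      have h2 : (81 * (n : ℝ) ^ 2 + 18 * n) * (2 * n * K ^ 2) ≤
          (99 * (n : ℝ) ^ 2) * (2 * n * K ^ 2) := by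
        refine mul_le_mul_of_nonneg_right (by linarith) (by positivity)
      have h3 : 0 ≤ (n : ℝ) ^ 3 * K ^ 2 := by positivity
      linarith

theorem abs_sub_inv_sqrt_six_le {x δ : ℝ} (hx : 0 ≤ x) (h : |x ^ 2 - 1 / 6| ≤ 1 / 3 * δ) :
    |x - 1 / √6| ≤ δ := by
  have h6 : 0 < √(6 : ℝ) := by positivity
  have h1 : x ^ 2 - 1 / 6 = (x - 1 / √6) * (x + 1 / √6) := by
    have : (1 / √(6 : ℝ)) ^ 2 = 1 / 6 := by
      rw [div_pow, one_pow, Real.sq_sqrt (by norm_num)]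
    rw [← this]
    ring
  have h2 : √(6 : ℝ) ≤ 3 := Real.sqrt_le_iff.2 ⟨by norm_num, by norm_num⟩
  have h3 : 1 / 3 ≤ x + 1 / √6 := by
    have := one_div_le_one_div_of_le h6 h2
    linarith
  rw [h1, abs_mul, abs_of_nonneg (show 0 ≤ x + 1 / √6 by linarith)] at h
  have h4 := mul_le_mul_of_nonneg_left h3 (abs_nonneg (x - 1 / √6))
  linarith

theorem normDist_sq {p : ℕ} (hp : p.Prime) (hp2 : p ≠ 2) (N : ℕ) (a b : Fin (p - 1) → ℤ) :
    normDist p N (cycPoint p a) (cycPoint p b) ^ 2 =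
      ((p : ℝ) ^ 2 * ∑ i, ((b i : ℝ) - a i) ^ 2 - (p + 1) * (∑ i, ((b i : ℝ) - a i)) ^ 2) /
        (2 * N * p * √(p - 1)) ^ 2 := by
  rw [normDist, div_pow, cycDist_sq hp, cycDiam_eq hp hp2]

theorem normDist_nonneg {p : ℕ} (hp : p.Prime) (hp2 : p ≠ 2) (N : ℕ) (α β : CycField p) :
    0 ≤ normDist p N α β := by
  rw [normDist, cycDiam_eq hp hp2]
  exact div_nonneg (cycDist_nonneg _ _ _) (by positivity)

/-- The associated vectors of the `K`-tuples of points of the box. -/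
noncomputable abbrev boxTuples (K p N : ℕ) : Finset (Fin K → Fin (p - 1) → ℤ) :=
  Fintype.piFinset fun _ => Fintype.piFinset fun _ => symIcc N

open Classical in
theorem ncard_selfVisible_inter {p : ℕ} (hp : p.Prime) (K N : ℕ)
    (P : (Fin K → CycField p) → Prop) :
    {α ∈ selfVisible K p N | P α}.ncard =
      ((boxTuples K p N).filter fun a =>
        (∀ j k, j ≠ k → CycVisible p N (cycPoint p (a j)) (cycPoint p (a k))) ∧
          P fun j => cycPoint p (a j)).card := by
  have hinj : Function.Injective fun (a : Fin K → Fin (p - 1) → ℤ) j => cycPoint p (a j) :=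
    fun a b h => funext fun j => cycPoint_injective hp (congrFun h j)
  rw [← Set.ncard_coe_finset, ← Set.ncard_image_of_injective _ hinj]
  congr 1
  ext α
  simp only [Set.mem_ofPred_eq, selfVisible, Set.mem_image, Finset.coe_filter,
    Fintype.mem_piFinset]
  constructor
  · rintro ⟨⟨hbox, hvis⟩, hP⟩
    choose a ha hα using hbox
    obtain rfl : (fun j => cycPoint p (a j)) = α := funext hα
    exact ⟨a, ⟨fun j i => Finset.mem_Icc.2 (ha j i), hvis, hP⟩, rfl⟩
  · rintro ⟨a, ⟨ha, hvis, hP⟩, rfl⟩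
    exact ⟨⟨fun j => ⟨a j, fun i => Finset.mem_Icc.1 (ha j i), rfl⟩, hvis⟩, hP⟩

open Classical in
theorem one_sub_le_ratio {n K p N : ℕ} (hn : 0 < n) (hK : 0 < K) (hp : p.Prime)
    (hpC : 200 * n ^ 3 * K ^ 2 < p) (hN : n ≤ N) (hN2 : 2 ≤ N) {ε : ℝ} (hε : 1 / (n : ℝ) ≤ ε) :
    1 - ε ≤
      (({α ∈ selfVisible K p N |
          ∀ j k : Fin K, j < k → |normDist p N (α j) (α k) - 1 / √6| ≤ ε}.ncard : ℕ) : ℝ) /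
        ((selfVisible K p N).ncard : ℝ) := by
  have hn' : (0 : ℝ) < n := by exact_mod_cast hn
  have hK' : (0 : ℝ) < K := by exact_mod_cast hK
  have hnK : K ^ 2 ≤ n ^ 3 * K ^ 2 := Nat.le_mul_of_pos_left _ (by positivity)
  have hK1 : 1 ≤ K ^ 2 := Nat.one_le_pow _ _ hK
  have hpK : 200 * K ^ 2 < p := by
    rw [mul_assoc] at hpC
    omega
  have hp2 : p ≠ 2 := by omega
  obtain ⟨V, hVdef⟩ : ∃ V : (Fin (p - 1) → ℤ) → (Fin (p - 1) → ℤ) → Prop, ∀ a b, V a b ↔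
      (∀ i, a i ∈ symIcc N) ∧ (∀ i, b i ∈ symIcc N) ∧
        ¬ CycVisible p N (cycPoint p a) (cycPoint p b) := ⟨_, fun _ _ => Iff.rfl⟩
  obtain ⟨R, hRdef⟩ : ∃ R : (Fin (p - 1) → ℤ) → (Fin (p - 1) → ℤ) → Prop, ∀ a b, R a b ↔
      1 / (3 * n : ℝ) < |((p : ℝ) ^ 2 * ∑ i, ((b i : ℝ) - a i) ^ 2 -
        (p + 1) * (∑ i, ((b i : ℝ) - a i)) ^ 2) / (2 * N * p * √(p - 1)) ^ 2 - 1 / 6| :=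
    ⟨_, fun _ _ => Iff.rfl⟩
  have hne : (symIcc N).Nonempty := ⟨0, by simp⟩
  set A := boxTuples K p N with hA
  have hA0 : (0 : ℝ) < A.card := by
    have : A.Nonempty := Fintype.piFinset_nonempty.2 fun _ => Fintype.piFinset_nonempty.2
      fun _ => hne
    exact_mod_cast this.card_pos
  set bad := A.filter fun α => ∃ j k, j ≠ k ∧ R (α j) (α k) with hbad
  set inv := A.filter fun α => ∃ j k, j ≠ k ∧ V (α j) (α k) with hinv
  have hR : (bad.card : ℝ) ≤ (Fintype.card (Fin K) : ℝ) ^ 2 * (1 / (2 * n * K ^ 2)) * A.card := by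
    convert! card_piFinset_filter_exists_rel_le (ι := Fin K) (p - 1) (symIcc N) hne R
      (le_trans (Nat.cast_le.2 (Finset.card_le_card fun x hx => ?_))
        (card_abs_sub_one_sixth_le hn hK hpC hN))
    simp only [Finset.mem_filter, hRdef] at hx ⊢
    exact hx
  have hV : (inv.card : ℝ) ≤ (Fintype.card (Fin K) : ℝ) ^ 2 * (1 / (2 * K ^ 2)) * A.card := by
    convert! card_piFinset_filter_exists_rel_le (ι := Fin K) (p - 1) (symIcc N) hne V
      (le_trans (Nat.cast_le.2 (Finset.card_le_card fun x hx => ?_))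
        ((card_exists_dvd_sub_le (m := p - 1) (by omega) hN2).trans
          (mul_le_mul_of_nonneg_right (eight_mul_pow_le hK (by omega)) (by positivity))))
    simp only [Finset.mem_filter, hVdef] at hx
    rw [Finset.mem_filter]
    exact ⟨hx.1, exists_dvd_sub_of_not_cycVisible hp hx.2.1 hx.2.2.1 hx.2.2.2⟩
  rw [Fintype.card_fin] at hR hV
  have hR' : (bad.card : ℝ) ≤ A.card / (2 * n) := hR.trans_eq (by field_simp)
  have hV' : (inv.card : ℝ) ≤ A.card / 2 := hV.trans_eq (by field_simp)
  have hΩ := ncard_selfVisible_inter hp K N fun _ => True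
  have hG := ncard_selfVisible_inter hp K N fun α =>
    ∀ j k : Fin K, j < k → |normDist p N (α j) (α k) - 1 / √6| ≤ ε
  simp only [and_true, Set.ofPred_mem_eq] at hΩ
  rw [hΩ]
  set Ω := A.filter fun a => ∀ j k, j ≠ k → CycVisible p N (cycPoint p (a j)) (cycPoint p (a k))
    with hΩdef
  set G := A.filter fun a =>
    (∀ j k, j ≠ k → CycVisible p N (cycPoint p (a j)) (cycPoint p (a k))) ∧
      ∀ j k : Fin K, j < k →
        |normDist p N (cycPoint p (a j)) (cycPoint p (a k)) - 1 / √6| ≤ ε with hGdef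
  rw [hG.trans (show _ = G.card by rw [hGdef]; congr)]
  have h1 : A ⊆ Ω ∪ inv := by
    intro a ha
    have ha' : ∀ j i, a j i ∈ symIcc N := fun j =>
      Fintype.mem_piFinset.1 (Fintype.mem_piFinset.1 ha j)
    rw [Finset.mem_union, hΩdef, hinv, Finset.mem_filter, Finset.mem_filter]
    by_cases h : ∀ j k, j ≠ k → CycVisible p N (cycPoint p (a j)) (cycPoint p (a k))
    · exact Or.inl ⟨ha, h⟩
    · push Not at h
      obtain ⟨j, k, hjk, h⟩ := h
      exact Or.inr ⟨ha, j, k, hjk, (hVdef _ _).2 ⟨ha' j, ha' k, h⟩⟩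
  have h2 : Ω ⊆ G ∪ bad := by
    intro a ha
    obtain ⟨haA, hvis⟩ := Finset.mem_filter.1 ha
    rw [Finset.mem_union, hGdef, hbad, Finset.mem_filter, Finset.mem_filter]
    by_cases h : ∃ j k, j ≠ k ∧ R (a j) (a k)
    · exact Or.inr ⟨haA, h⟩
    · push Not at h
      refine Or.inl ⟨haA, hvis, fun j k hjk => ?_⟩
      refine (abs_sub_inv_sqrt_six_le (δ := 1 / n) (normDist_nonneg hp hp2 _ _ _) ?_).trans hε
      rw [normDist_sq hp hp2]
      refine (not_lt.1 ((hRdef _ _).not.1 (h j k hjk.ne))).trans (le_of_eq ?_)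
      field_simp
  have h3 : (A.card : ℝ) ≤ Ω.card + inv.card := by
    exact_mod_cast (Finset.card_le_card h1).trans (Finset.card_union_le _ _)
  have h4 : (Ω.card : ℝ) ≤ G.card + bad.card := by
    exact_mod_cast (Finset.card_le_card h2).trans (Finset.card_union_le _ _)
  have hΩ0 : (0 : ℝ) < Ω.card := by linarith
  rw [le_div_iff₀ hΩ0]
  have h5 : (bad.card : ℝ) ≤ 1 / n * Ω.card := by
    calc (bad.card : ℝ) ≤ A.card / (2 * n) := hR'
      _ = 1 / n * (A.card / 2) := by field_simp
      _ ≤ _ := mul_le_mul_of_nonneg_left (by linarith) (by positivity)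
  have h6 := mul_le_mul_of_nonneg_right hε hΩ0.le
  linarith

theorem computable₂_bound : Computable₂ fun n K : ℕ => 200 * n ^ 3 * K ^ 2 := by
  have h : Primrec₂ fun n K : ℕ => 200 * (n * n * n) * (K * K) :=
    Primrec.nat_mul.comp
      (Primrec.nat_mul.comp (Primrec.const 200)
        (Primrec.nat_mul.comp (Primrec.nat_mul.comp Primrec.fst Primrec.fst) Primrec.fst))
      (Primrec.nat_mul.comp Primrec.snd Primrec.snd)
  refine h.to_comp.of_eq fun x => ?_
  ring

theorem mainTheorem10 :
    ∃ C : ℕ → ℕ → ℕ, Computable₂ C ∧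
      ∀ (ε : ℝ), 0 < ε → ∀ (K : ℕ), 2 ≤ K →
        ∀ (p : ℕ), p.Prime → C ⌈1 / ε⌉₊ K < p →
          ∀ (N : ℕ), 0 < N → (C ⌈1 / ε⌉₊ K : ℝ) ≤ (N : ℝ) / (p : ℝ) →
            1 - ε ≤
              (({α ∈ selfVisible K p N |
                  ∀ j k : Fin K, j < k → |normDist p N (α j) (α k) - 1 / √6| ≤ ε}.ncard : ℕ) : ℝ) /
                ((selfVisible K p N).ncard : ℝ) := by
  refine ⟨fun n K => 200 * n ^ 3 * K ^ 2, computable₂_bound, ?_⟩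
  intro ε hε K hK p hp hpC N hN hNC
  beta_reduce at hpC hNC
  set n := ⌈1 / ε⌉₊ with hn
  have hn0 : 0 < n := Nat.ceil_pos.2 (by positivity)
  have hn1 : 1 / (n : ℝ) ≤ ε := by
    rw [div_le_comm₀ (by exact_mod_cast hn0) hε]
    exact Nat.le_ceil _
  have hC : n ≤ 200 * n ^ 3 * K ^ 2 := by
    calc n ≤ n ^ 3 := Nat.le_self_pow (by norm_num) n
      _ ≤ n ^ 3 * (200 * K ^ 2) := Nat.le_mul_of_pos_right _ (by positivity)
      _ = _ := by ring
  have hNC' : 200 * n ^ 3 * K ^ 2 * p ≤ N := by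
    rw [le_div_iff₀ (by exact_mod_cast hp.pos)] at hNC
    exact_mod_cast hNC
  have hNp : p ≤ N := (Nat.le_mul_of_pos_left p (by omega)).trans hNC'
  exact one_sub_le_ratio hn0 (by omega) hp hpC ((hC.trans hpC.le).trans hNp)
    (hp.two_le.trans hNp) hn1
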